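/- Work with first-order formulas in the language of rings. A formula is existential with $m$ quantifiers if it is built from quantifier-free formulas using $\wedge$, $\vee$ and $\exists$, with $m$ occurrences of $\exists$. For a field $K$ and a formula $\varphi(X_1,\dots,X_n)$ with parameters from $K$, let $\mathrm{rk}^{\exists}_K(\varphi)\in\mathbb{N}_0\cup\{\infty\}$ be the infimum of all $m$ such that $\varphi$ is equivalent, modulo the complete theory of $K$ in the language of rings with constants for the elements of $K$, to an existential formula with $m$ quantifiers and parameters from $K$. For a definable set $D\subseteq K^n$ let $\mathrm{rk}^{\exists}_K(D)=\mathrm{rk}^{\exists}_K(\varphi)$ for any formula $\varphi$ with parameters from $K$ defining $D$, and let $\mathrm{rk}^{\exists}(K)$ be the supremum of $\mathrm{rk}^{\exists}_K(\varphi)$ over all existential formulas $\varphi$ with parameters from $K$ in any number of free variables. A field $K$ is large if, for every smooth geometrically integral $K$-scheme $X$ of finite type, the set $X(K)$ of $K$-rational points is either empty or Zariski-dense in $X$. Let $K$ be an imperfect large field of characteristic $p>0$. Then for every $n\in\mathbb{N}_0$ the formula $$\exists Y_1,\dots,Y_n\ \bigwedge_{i=1}^n X_i = Y_i^p,$$ equivalently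 the set of $n$-tuples of $p$-th powers in $K$ that it defines, has existential rank over $K$ exactly $n$. Moreover, for every finite field $\mathbb{F}_q$, $\mathrm{rk}^{\exists}(\mathbb{F}_q((t)))=\infty$. -/

import Mathlib

noncomputable section

namespace ExistentialRank

open CategoryTheory AlgebraicGeometry FirstOrder FirstOrder.Language

universe u v w

/-! ### Large fields -/

/-- The set of `K`-rational points of a `K`-scheme `f : X ⟶ Spec K`, i.e. the sections of `f`,
viewed as points of the underlying topological space of `X` (each section is identified with the
image of the unique point of `Spec K`). -/
def rationalPoints (K : Type u) [Field K] (X : Scheme.{u})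
    (f : X ⟶ Spec (CommRingCat.of K)) : Set X :=
  {x | ∃ s : Spec (CommRingCat.of K) ⟶ X, s ≫ f = 𝟙 _ ∧ ∃ z : Spec (CommRingCat.of K), s z = x}

/-- A field `K` is large if the set of `K`-rational points of any smooth geometrically integral
`K`-variety (that is, `K`-scheme of finite type) is either empty or Zariski-dense. -/
def IsLarge (K : Type u) [Field K] : Prop :=
  ∀ (X : Scheme.{u}) (f : X ⟶ Spec (CommRingCat.of K)),
    LocallyOfFiniteType f → QuasiCompact f → Smooth f → GeometricallyIntegral f →
      rationalPoints K X f = ∅ ∨ Dense (rationalPoints K X f)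

/-! ### Existential formulas and existential rank, for arbitrary languages -/

/-- `IsExists m φ`: the formula `φ` is built up from quantifier-free formulas using `∧`, `∨` and
`∃`, with exactly `m` quantifiers. -/
inductive IsExists {L : FirstOrder.Language.{u, v}} {α : Type w} :
    {k : ℕ} → ℕ → L.BoundedFormula α k → Prop
  | qf {k : ℕ} {φ : L.BoundedFormula α k} : φ.IsQF → IsExists 0 φ
  | and {k m₁ m₂ : ℕ} {φ₁ φ₂ : L.BoundedFormula α k} :
      IsExists m₁ φ₁ → IsExists m₂ φ₂ → IsExists (m₁ + m₂) (φ₁ ⊓ φ₂)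
  | or {k m₁ m₂ : ℕ} {φ₁ φ₂ : L.BoundedFormula α k} :
      IsExists m₁ φ₁ → IsExists m₂ φ₂ → IsExists (m₁ + m₂) (φ₁ ⊔ φ₂)
  | ex {k m : ℕ} {φ : L.BoundedFormula α (k + 1)} : IsExists m φ → IsExists (m + 1) φ.ex

/-- The existential rank of a formula `φ` with respect to a theory `T`: the least `m` such that
`φ` is equivalent modulo `T` to an existential formula with `m` quantifiers, and `∞` if there is
no such `m`. -/
def formulaRank {L : FirstOrder.Language.{u, v}} (T : L.Theory) {n : ℕ} (φ : L.Formula (Fin n)) : ℕ∞ :=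
  ⨅ (m : ℕ) (_ : ∃ ψ : L.Formula (Fin n), IsExists m ψ ∧ φ ⇔[T] ψ), (m : ℕ∞)

/-- The existential rank of a theory `T`: the supremum of the existential ranks with respect to
`T` of all existential formulas, in any number of free variables. -/
def theoryRank {L : FirstOrder.Language.{u, v}} (T : L.Theory) : ℕ∞ :=
  ⨆ (n : ℕ) (φ : L.Formula (Fin n)) (_ : ∃ m : ℕ, IsExists m φ), formulaRank T φ

/-! ### Existential rank over a field -/

/-- The complete theory of the field `K` in the language of rings with a constant symbol for each
element of `K`. -/
def fieldDiagram (K : Type u) [Field K] : (FirstOrder.Language.ring[[K]]).Theory :=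
  letI := FirstOrder.Ring.compatibleRingOfRing K
  FirstOrder.Language.ring.elementaryDiagram K

/-- The subset of `K ^ n` defined in the field `K` by a formula with parameters from `K`. -/
def definedSet (K : Type u) [Field K] {n : ℕ} (φ : (FirstOrder.Language.ring[[K]]).Formula (Fin n)) :
    Set (Fin n → K) :=
  letI := FirstOrder.Ring.compatibleRingOfRing K
  {x | φ.Realize x}

/-- The existential rank over the field `K` of a subset `D` of `K ^ n`: the common value of the
existential ranks of the formulas with parameters from `K` that define `D`. -/
def setRank (K : Type u) [Field K] {n : ℕ} (D : Set (Fin n → K)) : ℕ∞ :=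
  ⨅ (φ : (FirstOrder.Language.ring[[K]]).Formula (Fin n)) (_ : definedSet K φ = D),
    formulaRank (fieldDiagram K) φ

/-- The existential rank of the field `K`. -/
def fieldRank (K : Type u) [Field K] : ℕ∞ :=
  theoryRank (fieldDiagram K)

/-! ### Tuples of `m`-th powers -/

/-- The `m`-th power of a term in the language of rings. -/
def termPow {α : Type w} (t : FirstOrder.Language.ring.Term α) : ℕ → FirstOrder.Language.ring.Term α
  | 0 => 1
  | m + 1 => termPow t m * t

/-- The formula `∃ Y₁ … Yₙ, ⋀ᵢ Xᵢ = Yᵢ ^ m` in the free variables `X₁, …, Xₙ`. -/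
def powerFormula (n m : ℕ) : FirstOrder.Language.ring.Formula (Fin n) :=
  BoundedFormula.exs (L := FirstOrder.Language.ring) (α := Fin n) (n := n)
    (BoundedFormula.iInf fun i : Fin n =>
      Term.bdEqual (Term.var (Sum.inl i)) (termPow (Term.var (Sum.inr i)) m))

/-- The formula `powerFormula n m`, viewed as a formula with parameters from `K`. -/
def powerFormulaOver (K : Type u) (n m : ℕ) : (FirstOrder.Language.ring[[K]]).Formula (Fin n) :=
  (FirstOrder.Language.ring.lhomWithConstants K).onFormula (powerFormula n m)

/-- The set of `n`-tuples of `m`-th powers in `K`. -/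
def powerTuples (K : Type u) [Field K] (n m : ℕ) : Set (Fin n → K) :=
  {x | ∀ i, ∃ y : K, x i = y ^ m}

end ExistentialRank

end

/-! The power formula has `n` quantifiers, so only the lower bound needs an argument. Suppose the
`n`-tuples of `p`-th powers are the projection of a constructible set `W` in `K^n × K^m`. They are
Zariski-dense in `K^n`, so some irreducible closed subset has coordinate ring `A` in which the `n`
coordinates `x` are algebraically independent, has dense `K`-points, and on a nonempty open subset
its `K`-points lie in `W` (`HasCurvePoints.card_le_card_of_constructible`).

Density of `K`-points makes the fraction field of `A` separable over `K` by MacLane's criterion, so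
a separating transcendence basis `t` can be chosen among the `n + m` coordinates. If `m < n`, then
`t` has more than `m` elements and contains some `x i`. The variety is generically étale over the
affine space with coordinates `t`. Start from a rational point of the étale locus, fix the other
coordinates of `t` and move `x i` to `x i + u * s ^ p`, where `u` is not a `p`-th power. Lifting
this path to a rational point with `s ≠ 0` makes both values of `x i` `p`-th powers, hence also `u`,
a contradiction (`HasCurvePoints.card_le_card`).

The only arithmetic input is this lifting, isolated as `HasCurvePoints`. Large fields have it
because a branch of a plane curve at a simple rational point is geometrically integral
(`IsLarge.hasCurvePoints`). Laurent series fields have it by a direct fixed-point argument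
(`hasCurvePoints_laurentSeries`), so their largeness is never needed. -/

namespace ExistentialRank

universe u

/-! ### Rational points on curves and on standard étale algebras -/

section

open Polynomial

/-- Every simple point `(0, y₀)` on a monic plane curve `f(X, Y) = 0` over `K` lying in the open
set `g ≠ 0` is accompanied by points of the curve in `g ≠ 0` whose abscissa avoids the zeros of
any given nonzero polynomial. -/
def HasCurvePoints (K : Type u) [Field K] : Prop :=
  ∀ (f g : K[X][X]) (y₀ : K) (r : K[X]), f.Monic → f.evalEval 0 y₀ = 0 →
    f.derivative.evalEval 0 y₀ ≠ 0 → g.evalEval 0 y₀ ≠ 0 → r ≠ 0 →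
      ∃ s y : K, f.evalEval s y = 0 ∧ g.evalEval s y ≠ 0 ∧ r.eval s ≠ 0

lemma evalEval_map {R K : Type*} [CommRing R] [Field K] (φ : R →+* K[X]) (p : R[X]) (s y : K) :
    (p.map φ).evalEval s y = p.eval₂ ((evalRingHom s).comp φ) y := by
  rw [evalEval, eval_map, ← coe_evalRingHom, hom_eval₂, coe_evalRingHom, eval_C]

/-- Lifting a line on the base to a standard étale algebra through a given rational point. -/
theorem HasCurvePoints.exists_ringHom {K : Type u} [Field K] (hK : HasCurvePoints K)
    {R B : Type*} [CommRing R] [CommRing B] [Algebra R B] [Algebra.IsStandardEtale R B]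
    (σ : B →+* K) (φ : R →+* K[X])
    (hφ : (evalRingHom 0).comp φ = σ.comp (algebraMap R B)) {b : B} (hb : σ b ≠ 0)
    {r : K[X]} (hr : r ≠ 0) :
    ∃ (s : K) (σ' : B →+* K), σ'.comp (algebraMap R B) = (evalRingHom s).comp φ ∧
      σ' b ≠ 0 ∧ r.eval s ≠ 0 := by
  obtain ⟨P⟩ := Algebra.IsStandardEtale.nonempty_standardEtalePresentation (R := R) (S := B)
  -- Up to a power of the unit `P.g`, the element `b` is a polynomial `q` in the generator.
  -- Requiring `P.g * q ≠ 0` at the new point keeps it in the étale chart and keeps `b` nonzero.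
  obtain ⟨q, n, hq⟩ := P.exists_mul_aeval_x_g_pow_eq_aeval_x b
  have key (p : R[X]) : (p.map φ).evalEval 0 (σ P.x) = σ (aeval P.x p) := by
    rw [evalEval_map, hφ, aeval_def, hom_eval₂]
  have hg : σ (aeval P.x P.g) ≠ 0 := (P.hasMap.2.map σ).ne_zero
  obtain ⟨s, y, hf, hgq, hrs⟩ := hK (P.f.map φ) ((P.g * q).map φ) (σ P.x) r (P.monic_f.map φ)
    (by rw [key, P.hasMap.1, map_zero])
    (by rw [derivative_map, key]; exact (P.hasMap.isUnit_derivative_f.map σ).ne_zero)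
    (by
      rw [key, map_mul, map_mul, ← hq, map_mul, map_pow]
      exact mul_ne_zero hg (mul_ne_zero hb (pow_ne_zero _ hg))) hr
  let _ : Algebra R K := ((evalRingHom s).comp φ).toAlgebra
  rw [evalEval_map] at hf hgq
  change aeval y _ = 0 at hf
  change aeval y _ ≠ 0 at hgq
  rw [map_mul] at hgq
  have hy : P.P.HasMap y := ⟨hf, (left_ne_zero_of_mul hgq).isUnit⟩
  let τ : B →ₐ[R] K := (P.P.lift y hy).comp P.equivRing.toAlgHom
  have hτ : τ P.x = y := by simp [τ]
  refine ⟨s, τ, τ.comp_algebraMap, fun h ↦ right_ne_zero_of_mul hgq ?_, hrs⟩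
  have := congr(τ $hq)
  rw [map_mul, ← aeval_algHom_apply, hτ] at this
  rw [← this]
  erw [h]
  simp

end

/-! ### Geometric integrality and dense rational points -/

section

open Polynomial

section PowerSeriesTensor

open scoped TensorProduct PowerSeries

/-- An algebra over a field `K` that embeds into `K⟦X⟧` stays a domain under field extensions. -/
lemma isDomain_tensorProduct_of_injective_powerSeries {K A L : Type*} [Field K] [CommRing A]
    [Algebra K A] [Field L] [Algebra K L] (i : A →ₐ[K] K⟦X⟧) (hi : Function.Injective i) :
    IsDomain (A ⊗[K] L) := by
  let j : A ⊗[K] L →ₐ[K] L⟦X⟧ := Algebra.TensorProduct.lift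
    ((PowerSeries.mapAlgHom (Algebra.ofId K L)).comp i) (IsScalarTower.toAlgHom K L L⟦X⟧)
    (fun _ _ ↦ Commute.all _ _)
  have hj : Function.Injective j := by
    rw [injective_iff_map_eq_zero]
    classical
    intro z hz
    -- In a `K`-basis of `L`, each power series coefficient of the image of `∑ a k ⊗ b k` is a
    -- `K`-linear relation between basis vectors, so every `i (a k)` vanishes.
    let b := Module.Basis.ofVectorSpace K L
    obtain ⟨a, rfl⟩ := (TensorProduct.equivFinsuppOfBasisRight (M := A) b).symm.surjective z
    have hz' (n : ℕ) : ∑ k ∈ a.support, PowerSeries.coeff n (i (a k)) • b k = 0 := by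
      have := congr(PowerSeries.coeff n $hz)
      rw [TensorProduct.equivFinsuppOfBasisRight_symm_apply, Finsupp.sum, map_sum, map_sum,
        map_zero] at this
      rw [← this]
      refine Finset.sum_congr rfl fun k _ ↦ ?_
      simp only [j, Algebra.TensorProduct.lift_tmul, AlgHom.comp_apply, PowerSeries.mapAlgHom_apply,
        IsScalarTower.coe_toAlgHom', PowerSeries.algebraMap_apply, Algebra.algebraMap_self,
        RingHom.id_apply]
      rw [PowerSeries.coeff_mul_C, Algebra.smul_def]
      simp
    have ha : a = 0 := by
      ext k
      by_cases hk : k ∈ a.support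
      · refine hi ?_
        rw [Finsupp.zero_apply, map_zero]
        ext n
        exact linearIndependent_iff'.mp b.linearIndependent _ _ (hz' n) k hk
      · simpa using hk
    rw [ha, map_zero]
  exact hj.isDomain j.toRingHom

end PowerSeriesTensor

open CategoryTheory AlgebraicGeometry TensorProduct

lemma geometricallyIntegral_of_isDomain_tensorProduct {K A : Type u} [Field K] [CommRing A]
    [Algebra K A] (h : ∀ (L : Type u) [Field L] [Algebra K L], IsDomain (A ⊗[K] L)) :
    GeometricallyIntegral (Spec.map (CommRingCat.ofHom (algebraMap K A))) := by
  refine ⟨fun L _ y Z _ _ hZ ↦ ?_⟩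
  obtain ⟨φ, rfl⟩ := Spec.map_surjective y
  let _ : Algebra K L := φ.hom.toAlgebra
  have := h L
  let e : Z ≅ Spec (.of (A ⊗[K] L)) := hZ.isoPullback ≪≫ pullbackSpecIso K A L
  have : Nonempty Z := (inferInstance : Nonempty (Spec (.of (A ⊗[K] L)))).map e.inv
  exact isIntegral_of_isOpenImmersion e.hom

/-- Rational points of an affine scheme over a field are dense, expressed through algebra
homomorphisms. -/
lemma IsLarge.exists_algHom {K A : Type u} [Field K] [CommRing A] [Algebra K A] (hK : IsLarge K)
    [Algebra.Smooth K A] (h : ∀ (L : Type u) [Field L] [Algebra K L], IsDomain (A ⊗[K] L))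
    (σ : A →ₐ[K] K) {a : A} (ha : ¬ IsNilpotent a) : ∃ τ : A →ₐ[K] K, τ a ≠ 0 := by
  let f := Spec.map (CommRingCat.ofHom (algebraMap K A))
  have hf : Smooth f := by
    rw [HasRingHomProperty.Spec_iff (P := @Smooth)]
    exact RingHom.smooth_algebraMap.mpr inferInstance
  have hd : Dense (rationalPoints K _ f) := by
    refine (hK _ f inferInstance inferInstance hf
      (geometricallyIntegral_of_isDomain_tensorProduct h)).resolve_left ?_
    refine Set.Nonempty.ne_empty ⟨_, Spec.map (CommRingCat.ofHom σ.toRingHom), ?_,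
      (⊥ : PrimeSpectrum K), rfl⟩
    rw [← Spec.map_comp, ← CommRingCat.ofHom_comp]
    erw [σ.comp_algebraMap]
    exact Spec.map_id _
  have hne : (PrimeSpectrum.basicOpen a : Set (PrimeSpectrum A)).Nonempty := by
    rw [Set.nonempty_iff_ne_empty]
    exact fun h0 ↦ ha ((PrimeSpectrum.basicOpen_eq_bot_iff a).mp (SetLike.coe_injective h0))
  obtain ⟨_, hx, s, hs, z, rfl⟩ := hd.inter_open_nonempty
    (PrimeSpectrum.basicOpen a : Set (PrimeSpectrum A)) (PrimeSpectrum.basicOpen a).isOpen hne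
  obtain ⟨φ, rfl⟩ := Spec.map_surjective s
  rw [← Spec.map_comp, ← Spec.map_id] at hs
  have hφ := Spec.map_injective hs
  let τ : A →ₐ[K] K := ⟨φ.hom, fun r ↦ congr(($hφ).hom r)⟩
  refine ⟨τ, fun h0 ↦ hx ?_⟩
  have hmem : φ.hom a ∈ PrimeSpectrum.asIdeal z := by
    rw [show φ.hom a = 0 from h0]
    exact zero_mem _
  exact hmem

end

/-! ### Large fields have points on curves -/

section

open Polynomial

lemma map_aeval_eq_evalEval {K B : Type*} [Field K] [CommRing B] [Algebra K[X] B] (σ : B →+* K)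
    {s : K} (hσ : σ.comp (algebraMap K[X] B) = evalRingHom s) (b : B) (p : K[X][X]) :
    σ (aeval b p) = p.evalEval s (σ b) := by
  rw [aeval_def, hom_eval₂, hσ]
  conv_rhs => rw [← p.map_id, evalEval_map, RingHom.comp_id]

open scoped PowerSeries in
/-- Hensel's lemma at a simple point of a monic plane curve. -/
lemma exists_powerSeries_root {K : Type*} [Field K] (f : K[X][X]) (y₀ : K) (hf : f.Monic)
    (h0 : f.evalEval 0 y₀ = 0) (h1 : f.derivative.evalEval 0 y₀ ≠ 0) :
    ∃ y : K⟦X⟧, aeval y f = 0 ∧ PowerSeries.constantCoeff y = y₀ := by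
  have hc : (PowerSeries.constantCoeff (R := K)).comp (algebraMap K[X] K⟦X⟧) = evalRingHom 0 := by
    ext <;> simp [PowerSeries.algebraMap_apply']
  have key (p : K[X][X]) : PowerSeries.constantCoeff (aeval (PowerSeries.C y₀) p) =
      p.evalEval 0 y₀ := by
    rw [map_aeval_eq_evalEval _ hc, PowerSeries.constantCoeff_C]
  have hI (a : K⟦X⟧) : a ∈ Ideal.span {(PowerSeries.X : K⟦X⟧)} ↔
      PowerSeries.constantCoeff a = 0 := by
    rw [Ideal.mem_span_singleton, PowerSeries.X_dvd_iff]
  obtain ⟨y, hy, hy'⟩ := HenselianRing.is_henselian (I := Ideal.span {(PowerSeries.X : K⟦X⟧)})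
    (f.map (algebraMap K[X] K⟦X⟧)) (hf.map _) (PowerSeries.C y₀)
    (by rw [hI, eval_map_algebraMap, key, h0])
    (by
      rw [derivative_map, eval_map_algebraMap]
      refine IsUnit.map _ (PowerSeries.isUnit_iff_constantCoeff.mpr ?_)
      rw [key]
      exact h1.isUnit)
  refine ⟨y, by rwa [IsRoot.def, eval_map_algebraMap] at hy, ?_⟩
  rwa [hI, map_sub, PowerSeries.constantCoeff_C, sub_eq_zero] at hy'

open scoped PowerSeries in
-- Hensel's lemma gives a power series branch `y` of the curve at the simple point. The component
-- containing this branch, restricted to a smooth open part, has a coordinate ring that embeds in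
-- `K⟦X⟧`. It is therefore geometrically integral, and the constant coefficient is a rational point
-- on it. Largeness then provides a point where `r` does not vanish.
theorem IsLarge.hasCurvePoints {K : Type u} [Field K] (hK : IsLarge K) : HasCurvePoints K := by
  intro f g y₀ r hf hf0 hf1 hg hr
  obtain ⟨y, hy, rfl⟩ := exists_powerSeries_root f y₀ hf hf0 hf1
  have hc : (PowerSeries.constantCoeff (R := K)).comp (algebraMap K[X] K⟦X⟧) = evalRingHom 0 := by
    ext <;> simp [PowerSeries.algebraMap_apply']
  have key := map_aeval_eq_evalEval _ hc y
  have hinj : Function.Injective (algebraMap K[X] K⟦X⟧) := Polynomial.coe_injective K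
  have : Module.IsTorsionFree K[X] K⟦X⟧ := Module.isTorsionFree_iff_algebraMap_injective.mpr hinj
  have hint : IsIntegral K[X] y := ⟨f, hf, hy⟩
  -- The minimal polynomial cuts out the component through the branch. Since `f = f₁ * f₂` and `f₁`
  -- vanishes at the point, `f' = f₁' * f₂` there, so the point stays simple on `f₁`.
  obtain ⟨f₂, hf₂⟩ := minpoly.isIntegrallyClosed_dvd hint hy
  set f₁ := minpoly K[X] y with hf₁
  have hd : f₁.derivative.evalEval 0 (PowerSeries.constantCoeff y) ≠ 0 := by
    rw [hf₂, derivative_mul, ← key, map_add, map_mul, map_mul, minpoly.aeval, zero_mul, add_zero,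
      map_mul] at hf1
    rw [← key]
    exact left_ne_zero_of_mul hf1
  -- Inverting `f₁' * g` encodes both smoothness and `g ≠ 0`. The last entries witness `f₁' * g + f₁
  -- * 0 = (f₁' * g) ^ 1`.
  let P : StandardEtalePair K[X] :=
    ⟨f₁, minpoly.monic hint, f₁.derivative * g, g, 0, 1, by simp⟩
  have hP : P.HasMap y := by
    refine ⟨minpoly.aeval _ _, PowerSeries.isUnit_iff_constantCoeff.mpr ?_⟩
    rw [map_mul, map_mul, key, key]
    exact (mul_ne_zero hd hg).isUnit
  let _ : Algebra K P.Ring := ((algebraMap K[X] P.Ring).comp C).toAlgebra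
  have : IsScalarTower K K[X] P.Ring := .of_algebraMap_eq' rfl
  have : IsScalarTower K K[X] K⟦X⟧ := .of_algebraMap_eq fun x ↦ by
    simp [PowerSeries.algebraMap_apply']
  let Q : StandardEtalePresentation K[X] P.Ring :=
    ⟨P, P.X, P.hasMap_X, by simpa [StandardEtalePair.lift_X_left] using Function.bijective_id⟩
  let i := (P.lift y hP).restrictScalars K
  have hi : Function.Injective i := by
    rw [injective_iff_map_eq_zero]
    intro x hx
    obtain ⟨p, n, hp⟩ := Q.exists_mul_aeval_x_g_pow_eq_aeval_x x
    have hpy : aeval y p = 0 := by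
      have := congr(P.lift y hP $hp)
      rw [map_mul, ← aeval_algHom_apply] at this
      change i x * _ = aeval (P.lift y hP P.X) p at this
      rwa [hx, zero_mul, P.lift_X, eq_comm] at this
    obtain ⟨q, rfl⟩ := minpoly.isIntegrallyClosed_dvd hint hpy
    rw [map_mul (aeval Q.x) (minpoly K[X] y),
      show aeval Q.x (minpoly K[X] y) = 0 from P.hasMap_X.1, zero_mul] at hp
    exact (Q.hasMap.2.pow n).mul_left_eq_zero.mp hp
  have : Algebra.FinitePresentation K K[X] :=
    .equiv (MvPolynomial.uniqueAlgEquiv K PUnit.{1})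
  have : Algebra.Smooth K K[X] := {}
  have : Algebra.Smooth K P.Ring := .comp K K[X] P.Ring
  let σ : P.Ring →ₐ[K] K := (⟨PowerSeries.constantCoeff, fun x ↦ by simp⟩ : K⟦X⟧ →ₐ[K] K).comp i
  obtain ⟨τ, hτ⟩ := hK.exists_algHom
    (fun L _ _ ↦ isDomain_tensorProduct_of_injective_powerSeries i hi) σ
    (a := algebraMap K[X] P.Ring r) (fun h ↦ hr (hinj (by
      have := (h.map i.toRingHom).eq_zero
      erw [(P.lift y hP).commutes r] at this
      rw [this, map_zero])))
  have hs : (τ : P.Ring →+* K).comp (algebraMap K[X] P.Ring) =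
      evalRingHom (τ (algebraMap K[X] P.Ring X)) := by
    ext x
    · exact (τ.commutes x).trans (by simp)
    · simp
  have key' := map_aeval_eq_evalEval _ hs P.X
  refine ⟨τ (algebraMap K[X] P.Ring X), τ P.X, ?_, ?_, ?_⟩
  · erw [← key', hf₂, map_mul, show aeval P.X f₁ = 0 from P.hasMap_X.1, zero_mul, map_zero]
  · erw [← key']
    have h := P.hasMap_X.2
    rw [map_mul] at h
    exact ((isUnit_of_mul_isUnit_right h).map τ).ne_zero
  · rw [← coe_evalRingHom, ← hs]
    exact hτ

end

/-! ### Laurent series fields have points on curves -/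

section

open Polynomial

open Filter
open scoped PowerSeries LaurentSeries

variable {F : Type*} [Field F]

/-- A contraction of the form `y ↦ X * G(y)` has a fixed point in `F⟦X⟧`. -/
lemma exists_eq_X_mul_eval (G : F⟦X⟧[X]) : ∃ y : F⟦X⟧, y = PowerSeries.X * G.eval y := by
  let I : Ideal F⟦X⟧ := Ideal.span {PowerSeries.X}
  have hI (n : ℕ) (a b : F⟦X⟧) :
      a ≡ b [SMOD (I ^ n • ⊤ : Ideal F⟦X⟧)] ↔ PowerSeries.X ^ n ∣ a - b := by
    rw [SModEq.sub_mem, smul_eq_mul, Ideal.mul_top, Ideal.span_singleton_pow,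
      Ideal.mem_span_singleton]
  let c : ℕ → F⟦X⟧ := fun n ↦ (fun y ↦ PowerSeries.X * G.eval y)^[n] 0
  have hc (n : ℕ) : c (n + 1) = PowerSeries.X * G.eval (c n) := Function.iterate_succ_apply' _ _ _
  -- Since `a - b` divides `G(a) - G(b)`, each iteration gains one factor `X`, so the iterates form
  -- a Cauchy sequence.
  have hstep (n : ℕ) : PowerSeries.X ^ n ∣ c n - c (n + 1) := by
    induction n with
    | zero => simp
    | succ n ih =>
      rw [hc n, hc (n + 1), ← mul_sub, pow_succ']
      exact mul_dvd_mul_left _ (ih.trans (sub_dvd_eval_sub _ _ _))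
  obtain ⟨y, hy⟩ := IsPrecomplete.prec (I := I) (M := F⟦X⟧) inferInstance (f := c)
    (fun {m n} hmn ↦ by
      induction n, hmn using Nat.le_induction with
      | base => rfl
      | succ n hmn ih =>
        exact ih.trans ((hI _ _ _).mpr ((pow_dvd_pow _ hmn).trans (hstep n))))
  refine ⟨y, sub_eq_zero.mp (IsHausdorff.haus (I := I) inferInstance _ fun n ↦ ?_)⟩
  rw [hI, sub_zero]
  have h1 := (hI _ _ _).mp (hy n)
  have h2 := (pow_dvd_pow _ n.le_succ).trans ((hI _ _ _).mp (hy (n + 1)))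
  rw [hc] at h2
  have h3 : PowerSeries.X ^ n ∣ PowerSeries.X * G.eval (c n) - PowerSeries.X * G.eval y := by
    rw [← mul_sub]
    exact (h1.trans (sub_dvd_eval_sub _ _ _)).mul_left _
  have := (h3.sub h2)
  simpa using this

variable (F) in
/-- The uniformizer of the field of Laurent series. -/
noncomputable abbrev uniformizer : F⸨X⸩ := algebraMap F⟦X⟧ F⸨X⸩ PowerSeries.X

lemma eventually_exists_pow_mul_eq (c : F⸨X⸩) :
    ∀ᶠ M : ℕ in atTop, ∃ d : F⟦X⟧,
      uniformizer F ^ M * c = algebraMap F⟦X⟧ F⸨X⸩ (PowerSeries.X * d) := by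
  obtain ⟨⟨a, _, n, rfl⟩, h⟩ := IsLocalization.surj (Submonoid.powers (PowerSeries.X : F⟦X⟧)) c
  filter_upwards [eventually_ge_atTop (n + 1)] with M hM
  obtain ⟨k, rfl⟩ := Nat.exists_eq_add_of_le hM
  refine ⟨PowerSeries.X ^ k * a, ?_⟩
  simp only [map_mul, map_pow] at h ⊢
  rw [← h]
  ring

/-- After a sufficiently strong rescaling, bivariate polynomials over `F⸨X⸩` become integral. -/
lemma eventually_exists_pow_mul_evalEval_eq (h : F⸨X⸩[X][X]) :
    ∀ᶠ M : ℕ in atTop, ∃ H : F⟦X⟧[X], ∀ y : F⟦X⟧,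
      uniformizer F ^ M * h.evalEval (uniformizer F ^ (2 * M))
        (uniformizer F ^ M * algebraMap F⟦X⟧ F⸨X⸩ y) =
        algebraMap F⟦X⟧ F⸨X⸩ (PowerSeries.X * H.eval y) := by
  induction h using Polynomial.induction_on' with
  | add p q hp hq =>
    filter_upwards [hp, hq] with M ⟨H₁, h₁⟩ ⟨H₂, h₂⟩
    refine ⟨H₁ + H₂, fun y ↦ ?_⟩
    rw [evalEval_add, mul_add, h₁, h₂, eval_add, mul_add, map_add]
  | monomial j p =>
    induction p using Polynomial.induction_on' with
    | add p q hp hq =>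
      filter_upwards [hp, hq] with M ⟨H₁, h₁⟩ ⟨H₂, h₂⟩
      refine ⟨H₁ + H₂, fun y ↦ ?_⟩
      rw [map_add, evalEval_add, mul_add, h₁, h₂, eval_add, mul_add, map_add]
    | monomial i c =>
      filter_upwards [eventually_exists_pow_mul_eq c] with M ⟨d, hd⟩
      refine ⟨C (d * (PowerSeries.X ^ (2 * M)) ^ i * (PowerSeries.X ^ M) ^ j) * X ^ j,
        fun y ↦ ?_⟩
      simp only [evalEval, eval_monomial, eval_mul, eval_pow, eval_C, eval_X, map_mul, map_pow]
        at hd ⊢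
      linear_combination (uniformizer F ^ (2 * M)) ^ i * (uniformizer F ^ M) ^ j *
        algebraMap F⟦X⟧ F⸨X⸩ y ^ j * hd

lemma evalEval_taylor_C {K : Type*} [CommRing K] (f : K[X][X]) (y₀ s y : K) :
    (taylor (C y₀) f).evalEval s y = f.evalEval s (y + y₀) := by
  rw [evalEval, taylor_eval, ← C_add, evalEval]

lemma eq_C_eval_zero_add_X_mul {K : Type*} [CommRing K] (p : K[X]) :
    p = C (p.eval 0) + X * p.divX := by
  rw [← coeff_zero_eq_eval_zero, X_mul, add_comm, divX_mul_X_add]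

/-- Write `T` for the uniformizer. Expanding at the given point, `f = 0` reads `y + s * A + y ^ 2 *
D = 0`. Substituting `s = T ^ (2 * M)` and `T ^ M * y` for `y`, then dividing by `T ^ M`, leaves a
factor `T ^ M` in front of both `A` and `D`. For large `M` this factor absorbs all denominators and
the equation becomes a contraction `y = X * G(y)` over `F⟦X⟧`. -/
theorem hasCurvePoints_laurentSeries : HasCurvePoints F⸨X⸩ := by
  classical
  intro f g y₀ r _ hf0 hf1 hg hr
  set b := f.derivative.evalEval 0 y₀
  set g₀ := g.evalEval 0 y₀
  -- the quadratic expansion of `f` at the given point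
  obtain ⟨A, D, hAD⟩ : ∃ A D : F⸨X⸩[X][X], ∀ s y, f.evalEval s (y + y₀) =
      b * y + b * (s * A.evalEval s y + y ^ 2 * D.evalEval s y) := by
    have h1 := divX_mul_X_add (taylor (C y₀) f)
    have h2 := divX_mul_X_add (taylor (C y₀) f).divX
    rw [coeff_divX, zero_add, taylor_coeff_one, eq_C_eval_zero_add_X_mul (eval _ _)] at h2
    rw [taylor_coeff_zero, ← h2, eq_C_eval_zero_add_X_mul (eval _ f)] at h1
    rw [show eval 0 (eval (C y₀) f) = 0 from hf0,
      show eval 0 (eval (C y₀) f.derivative) = b from rfl,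
      C_0, zero_add] at h1
    refine ⟨C (C b⁻¹) * (C (eval (C y₀) f).divX + C (eval (C y₀) f.derivative).divX * X),
      C (C b⁻¹) * (taylor (C y₀) f).divX.divX, fun s y ↦ ?_⟩
    have h3 := congr(Polynomial.evalEval s y $h1)
    rw [evalEval_taylor_C] at h3
    rw [← h3]
    simp only [evalEval_add, evalEval_mul, evalEval_C, evalEval_X, eval_add, eval_mul, eval_C,
      eval_X]
    field_simp
    ring
  obtain ⟨A', B', hAB⟩ : ∃ A B : F⸨X⸩[X][X], ∀ s y, g.evalEval s (y + y₀) =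
      g₀ * (1 + (s * A.evalEval s y + y * B.evalEval s y)) := by
    have h1 := divX_mul_X_add (taylor (C y₀) g)
    rw [taylor_coeff_zero, eq_C_eval_zero_add_X_mul (eval _ g),
      show eval 0 (eval (C y₀) g) = g₀ from rfl] at h1
    refine ⟨C (C g₀⁻¹) * C (eval (C y₀) g).divX, C (C g₀⁻¹) * (taylor (C y₀) g).divX,
      fun s y ↦ ?_⟩
    have h3 := congr(Polynomial.evalEval s y $h1)
    rw [evalEval_taylor_C] at h3
    rw [← h3]
    simp only [evalEval_add, evalEval_mul, evalEval_C, evalEval_X, eval_add, eval_mul, eval_C,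
      eval_X]
    field_simp
    ring
  have hinj : Function.Injective (algebraMap F⟦X⟧ F⸨X⸩) := HahnSeries.ofPowerSeries_injective
  have hT : Function.Injective fun M : ℕ ↦ uniformizer F ^ (2 * M) := by
    intro m n hmn
    have := hinj (by simpa only [map_pow] using hmn : algebraMap F⟦X⟧ F⸨X⸩ (PowerSeries.X ^ (2 * m))
      = algebraMap F⟦X⟧ F⸨X⸩ (PowerSeries.X ^ (2 * n)))
    have := congr(PowerSeries.order $this)
    rw [PowerSeries.order_X_pow, PowerSeries.order_X_pow] at this
    have := Nat.cast_injective this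
    omega
  -- Different `M` give different abscissas, and `r` has finitely many roots.
  have hev : ∀ᶠ M : ℕ in atTop, r.eval (uniformizer F ^ (2 * M)) ≠ 0 := by
    rw [← Nat.cofinite_eq_atTop]
    have := (r.roots.toFinset.finite_toSet).preimage hT.injOn
    filter_upwards [this.compl_mem_cofinite] with M hM h0
    exact hM (by simpa [hr] using h0)
  obtain ⟨M, hM, ⟨H₁, h₁⟩, ⟨H₂, h₂⟩, ⟨H₃, h₃⟩, ⟨H₄, h₄⟩⟩ := (hev.and
    ((eventually_exists_pow_mul_evalEval_eq A).and ((eventually_exists_pow_mul_evalEval_eq D).and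
    ((eventually_exists_pow_mul_evalEval_eq A').and
      (eventually_exists_pow_mul_evalEval_eq B'))))).exists
  obtain ⟨y, hy⟩ := exists_eq_X_mul_eval (-(H₁ + X ^ 2 * H₂) : F⟦X⟧[X])
  have hy' := congr(algebraMap F⟦X⟧ F⸨X⸩ $hy)
  simp only [eval_neg, eval_add, eval_mul, eval_pow, eval_X, map_mul, map_neg, map_add,
    map_pow] at hy'
  specialize h₁ y
  specialize h₂ y
  specialize h₃ y
  specialize h₄ y
  refine ⟨uniformizer F ^ (2 * M), uniformizer F ^ M * algebraMap _ _ y + y₀, ?_, ?_, hM⟩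
  · rw [hAD]
    rw [map_mul] at h₁ h₂
    linear_combination b * uniformizer F ^ M * h₁ +
      b * uniformizer F ^ M * algebraMap F⟦X⟧ F⸨X⸩ y ^ 2 * h₂ +
      b * uniformizer F ^ M * hy'
  · rw [hAB]
    refine mul_ne_zero hg ?_
    -- After the same rescaling, `g` is its value at the given point times a power series with
    -- constant coefficient `1`.
    have : 1 + (uniformizer F ^ (2 * M) *
          A'.evalEval (uniformizer F ^ (2 * M)) (uniformizer F ^ M * algebraMap _ _ y) +
        uniformizer F ^ M * algebraMap _ _ y *
          B'.evalEval (uniformizer F ^ (2 * M)) (uniformizer F ^ M * algebraMap _ _ y)) =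
        algebraMap F⟦X⟧ F⸨X⸩
          (1 + PowerSeries.X * (PowerSeries.X ^ M * H₃.eval y + y * H₄.eval y)) := by
      simp only [map_add, map_one, map_mul, map_pow] at h₃ h₄ ⊢
      linear_combination uniformizer F ^ M * h₃ + algebraMap F⟦X⟧ F⸨X⸩ y * h₄
    rw [this, map_ne_zero_iff _ hinj]
    intro h0
    simpa using congr(PowerSeries.constantCoeff $h0)

end

/-! ### MacLane's criterion and separating transcendence bases -/

section

open Polynomial

/-- If the points in `K` of a domain `A` over `K` are dense, then the fraction field of `A`
satisfies MacLane's separability criterion over `K`. -/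
lemma linearIndepOn_pow_of_dense_algHom {K A F : Type*} [Field K] [CommRing A] [IsDomain A]
    [Algebra K A] [Field F] [Algebra A F] [IsFractionRing A F] [Algebra K F] [IsScalarTower K A F]
    (p : ℕ) [Fact p.Prime] [CharP K p] (hdense : ∀ a : A, a ≠ 0 → ∃ σ : A →ₐ[K] K, σ a ≠ 0)
    (s : Finset F) (hs : LinearIndepOn K id (s : Set F)) :
    LinearIndepOn K (· ^ p) (s : Set F) := by
  rw [linearIndepOn_finset_iff] at hs ⊢
  intro c hc b hb
  obtain ⟨⟨d, hd⟩, hda⟩ := IsLocalization.exist_integer_multiples_of_finset (nonZeroDivisors A) s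
  choose! a ha using hda
  have hd0 : algebraMap A F d ≠ 0 :=
    IsLocalization.to_map_ne_zero_of_mem_nonZeroDivisors F le_rfl hd
  replace ha (b : F) (hb : b ∈ s) : algebraMap A F (a b) = algebraMap A F d * b := by
    exact (ha b hb).trans (Algebra.smul_def d b)
  have hinj := IsFractionRing.injective A F
  have hsmul (k : K) (y : A) : algebraMap A F (k • y) = k • algebraMap A F y :=
    (IsScalarTower.toAlgHom K A F).toLinearMap.map_smul k y
  have hA : ∑ b ∈ s, c b • a b ^ p = 0 := by
    apply hinj
    have hterm (b : F) (hb : b ∈ s) :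
        algebraMap A F (c b • a b ^ p) = algebraMap A F d ^ p * (c b • b ^ p) := by
      rw [hsmul, map_pow, ha b hb, mul_pow, Algebra.mul_smul_comm]
    rw [map_sum, Finset.sum_congr rfl hterm, ← Finset.mul_sum, hc, mul_zero, map_zero]
  let K₀ := (frobenius K p).fieldRange
  let e := Module.Basis.ofVectorSpace K₀ K
  have hroot (k : K₀) : ∃ y : K, y ^ p = k := by
    obtain ⟨y, hy⟩ := RingHom.mem_fieldRange.mp k.2
    exact ⟨y, hy⟩
  choose root hroot using hroot
  -- At a rational point the values `σ (a b) ^ p` are scalars of `K^p`, so the relation splits into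
  -- coordinates over `K^p`. Each coordinate relation is the `p`-th power of the value of the sum
  -- here, which thus vanishes at all rational points and is zero by density.
  have hzero (j) : ∑ b ∈ s, root (e.coord j (c b)) • a b = 0 := by
    by_contra h0
    obtain ⟨σ, hσ⟩ := hdense _ h0
    refine hσ (pow_eq_zero_iff (Fact.out : p.Prime).ne_zero |>.mp ?_)
    have h1 : ∑ b ∈ s, σ (a b) ^ p * c b = 0 := by
      have := congr(σ $hA)
      simpa [map_sum, mul_comm] using this
    have h2 := congr(((e.coord j $h1 : K₀) : K))
    rw [map_sum, map_zero] at h2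
    have h3 (b : F) : e.coord j (σ (a b) ^ p * c b) =
        (⟨σ (a b) ^ p, σ (a b), rfl⟩ : K₀) * e.coord j (c b) := by
      rw [← smul_eq_mul (a := (⟨σ (a b) ^ p, σ (a b), rfl⟩ : K₀)), ← map_smul]
      rfl
    simp only [h3] at h2
    rw [map_sum, ← frobenius_def, map_sum]
    push_cast at h2
    refine Eq.trans ?_ h2
    refine Finset.sum_congr rfl fun b _ ↦ ?_
    rw [frobenius_def, map_smul, smul_eq_mul, mul_pow, hroot, mul_comm]
  have hcoord (j) : e.coord j (c b) = 0 := by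
    have h4 := hs (fun b ↦ root (e.coord j (c b))) (by
      have := congr(algebraMap A F $(hzero j))
      rw [map_sum, map_zero] at this
      have hterm (b : F) (hb : b ∈ s) : algebraMap A F (root (e.coord j (c b)) • a b) =
          algebraMap A F d * (root (e.coord j (c b)) • id b) := by
        rw [hsmul, ha b hb, Algebra.mul_smul_comm, id]
      rw [Finset.sum_congr rfl hterm, ← Finset.mul_sum] at this
      exact (mul_eq_zero.mp this).resolve_left hd0) b hb
    rw [← Subtype.coe_inj, ← hroot, h4, zero_pow (Fact.out : p.Prime).ne_zero]
    rfl
  exact e.forall_coord_eq_zero_iff.mp hcoord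

open IntermediateField in
/-- Under MacLane's criterion, any finite generating set contains a separating transcendence
basis. -/
lemma exists_subset_isTranscendenceBasis_isSeparable {k E : Type*} [Field k] [Field E]
    [Algebra k E] (p : ℕ) [Fact p.Prime] [ExpChar k p]
    (H : ∀ s : Finset E, LinearIndepOn k id (s : Set E) → LinearIndepOn k (· ^ p) (s : Set E))
    (S : Finset E) (hS : IntermediateField.adjoin k (S : Set E) = ⊤) :
    ∃ t ⊆ (S : Set E), IsTranscendenceBasis k ((↑) : t → E) ∧
      Algebra.IsSeparable (adjoin k t) E := by
  classical
  let 𝒯 : Set (Set E) := {t | t ⊆ S ∧ IsTranscendenceBasis k ((↑) : t → E)}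
  have hfin : 𝒯.Finite := (S.finite_toSet.finite_subsets).subset fun t ht ↦ ht.1
  have hne : 𝒯.Nonempty := by
    have : Algebra.IsAlgebraic (Algebra.adjoin k (S : Set E)) E := by
      rw [← isAlgebraic_adjoin_iff_top, hS, Algebra.isAlgebraic_iff_isIntegral]
      exact Algebra.isIntegral_of_surjective topEquiv.surjective
    obtain ⟨t, hts, ht⟩ := exists_isTranscendenceBasis_subset (R := k) (S : Set E)
    exact ⟨t, hts, ht⟩
  let sep (t : Set E) : IntermediateField k E := (separableClosure (adjoin k t) E).restrictScalars k
  -- Choose the basis whose separable closure contains as many generators as possible. If a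
  -- generator `n` were missed, MacLane's criterion would exchange some `i` for `n` with `i`
  -- separable over the new basis, which would then capture `n` as well.
  obtain ⟨t, ht, hmax⟩ := hfin.exists_maximalFor (fun t ↦ (S.filter (· ∈ sep t))) 𝒯 hne
  refine ⟨t, ht.1, ht.2, ?_⟩
  rw [← separableClosure.eq_top_iff, ← (restrictScalars_injective k).eq_iff,
    restrictScalars_top, eq_top_iff, ← hS, adjoin_le_iff]
  intro n hn
  by_contra hnt
  have hns : n ∉ t := fun h ↦ hnt (le_restrictScalars_separableClosure _ (subset_adjoin _ _ h))
  obtain ⟨i, hi₁, hi₂⟩ := exists_isTranscendenceBasis_and_isSeparable_of_linearIndepOn_pow'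
    p Fact.out (a := id) H t n ht.2 hns
  rw [Set.image_id] at hi₂
  have hle : sep t ≤ sep (insert n t \ {i}) := by
    rw [separableClosure_le_separableClosure_iff, adjoin_le_iff]
    intro x hx
    obtain rfl | hne := eq_or_ne x i
    exacts [hi₂, le_restrictScalars_separableClosure _ (subset_adjoin _ _ ⟨.inr hx, hne⟩)]
  have hn' : n ∈ sep (insert n t \ {i}) := by
    obtain rfl | hne := eq_or_ne n i
    exacts [hi₂, le_restrictScalars_separableClosure _ (subset_adjoin _ _ ⟨.inl rfl, hne⟩)]
  have := hmax (j := insert n t \ {i})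
    ⟨Set.sdiff_subset.trans (Set.insert_subset hn ht.1), hi₁⟩
    (Finset.monotone_filter_right _ fun x _ hx ↦ hle hx)
    (Finset.mem_filter.mpr ⟨hn, hn'⟩)
  exact hnt (Finset.mem_filter.mp this).2

end

/-! ### Generic étaleness and the bound on the number of coordinates -/

section

open Polynomial

/-- A variety is generically étale over the affine space given by a separating transcendence
basis. -/
theorem exists_isStandardEtale_of_isSeparable {K A F ι : Type*} [Field K] [CommRing A] [IsDomain A]
    [Algebra K A] [Algebra.FiniteType K A] [Field F] [Algebra A F] [IsFractionRing A F]
    [Algebra K F] [IsScalarTower K A F] [Finite ι] [Algebra (MvPolynomial ι K) A]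
    [IsScalarTower K (MvPolynomial ι K) A] (v : ι → F)
    (hv : ∀ i, v i = algebraMap A F (algebraMap (MvPolynomial ι K) A (MvPolynomial.X i)))
    (hind : AlgebraicIndependent K v)
    (hsep : Algebra.IsSeparable (IntermediateField.adjoin K (Set.range v)) F) :
    ∃ f : A, f ≠ 0 ∧ Algebra.IsStandardEtale (MvPolynomial ι K) (Localization.Away f) := by
  let _ : Algebra (MvPolynomial ι K) F :=
    ((algebraMap A F).comp (algebraMap (MvPolynomial ι K) A)).toAlgebra
  have : IsScalarTower (MvPolynomial ι K) A F := .of_algebraMap_eq' rfl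
  have : IsScalarTower K (MvPolynomial ι K) F := .of_algebraMap_eq fun x ↦ by
    rw [IsScalarTower.algebraMap_apply (MvPolynomial ι K) A F,
      ← IsScalarTower.algebraMap_apply K (MvPolynomial ι K) A,
      ← IsScalarTower.algebraMap_apply K A F]
  have hRF : IsScalarTower.toAlgHom K (MvPolynomial ι K) F = MvPolynomial.aeval v := by
    ext i
    rw [MvPolynomial.aeval_X, hv]
    rfl
  have hinj : Function.Injective (algebraMap (MvPolynomial ι K) F) := by
    have := algebraicIndependent_iff_injective_aeval.mp hind
    rwa [← hRF] at this
  have : FaithfulSMul (MvPolynomial ι K) F :=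
    (faithfulSMul_iff_algebraMap_injective (MvPolynomial ι K) F).mpr hinj
  let _ : Algebra (FractionRing (MvPolynomial ι K)) F :=
    FractionRing.liftAlgebra (MvPolynomial ι K) F
  have he : (algebraMap (FractionRing (MvPolynomial ι K)) F) =
      (algebraMap (IntermediateField.adjoin K (Set.range v)) F).comp
        hind.aevalEquivField.toRingEquiv.toRingHom := by
    refine IsLocalization.ringHom_ext (nonZeroDivisors (MvPolynomial ι K)) (RingHom.ext fun x ↦ ?_)
    rw [RingHom.comp_apply, ← IsScalarTower.algebraMap_apply]
    refine (congr($hRF x)).trans ?_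
    exact (hind.aevalEquivField_algebraMap_apply_coe x).symm
  have : Algebra.IsSeparable (FractionRing (MvPolynomial ι K)) F :=
    .of_equiv_equiv (A₁ := IntermediateField.adjoin K (Set.range v)) (B₁ := F)
      hind.aevalEquivField.symm.toRingEquiv (RingEquiv.refl F) (RingHom.ext fun x ↦ by
        obtain ⟨y, rfl⟩ := hind.aevalEquivField.surjective x
        simp only [he, RingHom.comp_apply]
        simp)
  have : Algebra.FormallyEtale (FractionRing (MvPolynomial ι K)) F := .of_isSeparable _ _
  have : Algebra.FormallyEtale (MvPolynomial ι K) (FractionRing (MvPolynomial ι K)) :=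
    .of_isLocalization (nonZeroDivisors (MvPolynomial ι K))
  have : Algebra.FormallyEtale (MvPolynomial ι K) F :=
    .comp (MvPolynomial ι K) (FractionRing (MvPolynomial ι K)) F
  -- `F` is the local ring at the generic point, so formal étaleness of `F` means étaleness at `⊥`,
  -- which spreads to a basic open set.
  have hbot : (⊥ : Ideal A).primeCompl = nonZeroDivisors A := by
    ext; simp [Ideal.primeCompl]
  have : IsLocalization (⊥ : Ideal A).primeCompl F := by rw [hbot]; infer_instance
  have : Algebra.IsEtaleAt (MvPolynomial ι K) (⊥ : Ideal A) :=
    .of_equiv (((IsLocalization.algEquiv (⊥ : Ideal A).primeCompl F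
      (Localization.AtPrime (⊥ : Ideal A))).restrictScalars (MvPolynomial ι K)))
  have : Algebra.FiniteType (MvPolynomial ι K) A :=
    .of_restrictScalars_finiteType K (MvPolynomial ι K) A
  have : Algebra.FinitePresentation (MvPolynomial ι K) A :=
    Algebra.FinitePresentation.of_finiteType.mp ‹_›
  obtain ⟨f, hf, h⟩ :=
    Algebra.IsEtaleAt.exists_isStandardEtale (R := MvPolynomial ι K) (⊥ : Ideal A)
  exact ⟨f, hf, h⟩

/-- If the points of an affine variety over an imperfect field are dense and the first coordinates
are generically `p`-th powers and algebraically independent, then there are at least as many other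
coordinates. -/
theorem HasCurvePoints.card_le_card {K : Type u} [Field K] (hK : HasCurvePoints K) (p : ℕ)
    [Fact p.Prime] [CharP K p] {u : K} (hu : ∀ y, u ≠ y ^ p) {A : Type*} [CommRing A] [IsDomain A]
    [Algebra K A] {ι κ : Type*} [Finite ι] [Finite κ] (x : ι → A) (y : κ → A)
    (hxy : Algebra.adjoin K (Set.range x ∪ Set.range y) = ⊤) (hind : AlgebraicIndependent K x)
    (hdense : ∀ a : A, a ≠ 0 → ∃ σ : A →ₐ[K] K, σ a ≠ 0) {g : A} (hg : g ≠ 0)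
    (hpow : ∀ σ : A →ₐ[K] K, σ g ≠ 0 → ∀ i, ∃ y, σ (x i) = y ^ p) :
    Nat.card ι ≤ Nat.card κ := by
  classical
  by_contra! hlt
  let F := FractionRing A
  have hinj : Function.Injective (algebraMap A F) := IsFractionRing.injective A F
  have hfin : (Set.range x ∪ Set.range y).Finite := (Set.finite_range _).union (Set.finite_range _)
  let S : Finset F := hfin.toFinset.image (algebraMap A F)
  have hS : IntermediateField.adjoin K (S : Set F) = ⊤ := by
    rw [eq_top_iff]
    have hA (a : A) : algebraMap A F a ∈ IntermediateField.adjoin K (S : Set F) := by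
      have h1 : a ∈ Algebra.adjoin K (Set.range x ∪ Set.range y) := hxy ▸ Algebra.mem_top
      have h2 := Set.mem_image_of_mem (IsScalarTower.toAlgHom K A F) h1
      rw [← Subalgebra.coe_map, AlgHom.map_adjoin] at h2
      refine IntermediateField.algebra_adjoin_le_adjoin _ _ ?_
      convert h2 using 2
      simp [S]
    rintro z -
    obtain ⟨a, b, -, rfl⟩ := IsFractionRing.div_surjective (A := A) z
    exact div_mem (hA a) (hA b)
  obtain ⟨t, htS, htb, hsep⟩ := exists_subset_isTranscendenceBasis_isSeparable p
    (linearIndepOn_pow_of_dense_algHom p hdense) S hS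
  have htS' (τ : t) : ∃ a : A, (a ∈ Set.range x ∪ Set.range y) ∧ algebraMap A F a = τ := by
    simpa [S] using htS τ.2
  choose w hw hwt using htS'
  have hfint : Finite t := S.finite_toSet.subset htS
  have hwinj : Function.Injective w := fun a b hab ↦ Subtype.ext (by rw [← hwt, hab, hwt])
  -- A basis consisting only of `y`-coordinates would have at most `Nat.card κ` elements, while
  -- independence of `x` forces at least `Nat.card ι`.
  obtain ⟨τ₀, i₀, hi₀⟩ : ∃ τ : t, ∃ i, x i = w τ := by
    by_contra! hno
    have hy (τ : t) : ∃ j, y j = w τ := (hw τ).resolve_left fun ⟨i, hi⟩ ↦ hno τ i hi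
    choose j hj using hy
    have hjinj : Function.Injective j := fun a b hab ↦ hwinj (by rw [← hj, hab, hj])
    have h1 := Nat.card_le_card_of_injective j hjinj
    have hindF : AlgebraicIndependent K (algebraMap A F ∘ x) :=
      hind.map' (f := IsScalarTower.toAlgHom K A F) hinj
    have h2 := hindF.lift_cardinalMk_le_trdeg
    rw [← htb.cardinalMk_eq_trdeg] at h2
    have h3 := Cardinal.toNat_le_toNat h2 (by simp [Cardinal.lift_lt_aleph0])
    rw [Cardinal.toNat_lift, Cardinal.toNat_lift] at h3
    exact absurd (h3.trans h1) (by simpa [Nat.card] using hlt)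
  let _ : Algebra (MvPolynomial t K) A := (MvPolynomial.aeval w).toAlgebra
  have : IsScalarTower K (MvPolynomial t K) A := .of_algebraMap_eq fun k ↦
    ((MvPolynomial.aeval w : MvPolynomial t K →ₐ[K] A).commutes k).symm
  have hRX (τ : t) : algebraMap (MvPolynomial t K) A (MvPolynomial.X τ) = w τ :=
    MvPolynomial.aeval_X _ _
  have : Algebra.FiniteType K A := ⟨⟨hfin.toFinset, by simpa using hxy⟩⟩
  obtain ⟨f, hf, _⟩ := exists_isStandardEtale_of_isSeparable (ι := t) (A := A) (F := F)
    ((↑) : t → F) (fun τ ↦ by rw [hRX, hwt]) htb.1 (by rwa [Subtype.range_coe])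
  obtain ⟨σ, hσ⟩ := hdense (f * g) (mul_ne_zero hf hg)
  rw [map_mul] at hσ
  let B := Localization.Away f
  let σB : B →+* K := IsLocalization.Away.lift (g := (σ : A →+* K)) f
    (IsUnit.mk0 _ (left_ne_zero_of_mul hσ))
  have hσB (a : A) : σB (algebraMap A B a) = σ a := IsLocalization.Away.lift_eq f _ a
  -- The path through the image of `σ` that moves only the coordinate `τ₀`, by `u * s ^ p`; it
  -- passes through that image at `s = 0`.
  let φ : MvPolynomial t K →ₐ[K] K[X] := MvPolynomial.aeval fun τ ↦
    C (σ (w τ)) + if τ = τ₀ then C u * X ^ p else 0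
  have hp0 : p ≠ 0 := (Fact.out : p.Prime).ne_zero
  obtain ⟨s, σ', hσ', hg', hs⟩ := hK.exists_ringHom (R := MvPolynomial t K) σB φ.toRingHom
    (MvPolynomial.ringHom_ext (fun k ↦ by
      rw [RingHom.comp_apply, RingHom.comp_apply, ← MvPolynomial.algebraMap_eq,
        ← IsScalarTower.algebraMap_apply, IsScalarTower.algebraMap_apply K A B, hσB]
      simp) (fun τ ↦ by
        rw [RingHom.comp_apply, RingHom.comp_apply,
          IsScalarTower.algebraMap_apply (MvPolynomial t K) A B, hσB, hRX]
        by_cases h : τ = τ₀ <;> simp [φ, h, hp0])) (b := algebraMap A B g)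
    (by rw [hσB]; exact right_ne_zero_of_mul hσ) (r := X) X_ne_zero
  rw [eval_X] at hs
  let ρ : A →ₐ[K] K := ⟨σ'.comp (algebraMap A B), fun k ↦ by
    have := congr($hσ' (MvPolynomial.C k))
    rw [RingHom.comp_apply, ← MvPolynomial.algebraMap_eq,
        ← IsScalarTower.algebraMap_apply, IsScalarTower.algebraMap_apply K A B] at this
    exact this.trans (by simp)⟩
  have hρ : ρ (w τ₀) = σ (w τ₀) + u * s ^ p := by
    have := congr($hσ' (MvPolynomial.X τ₀))
    rw [RingHom.comp_apply, IsScalarTower.algebraMap_apply (MvPolynomial t K) A B, hRX] at this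
    exact this.trans (by simp [φ])
  obtain ⟨a, ha⟩ := hpow σ (right_ne_zero_of_mul hσ) i₀
  obtain ⟨b, hb⟩ := hpow ρ hg' i₀
  rw [hi₀] at ha hb
  -- From `b ^ p = a ^ p + u * s ^ p`, additivity of Frobenius gives `u = ((b - a) / s) ^ p`.
  refine hu ((b - a) / s) ?_
  rw [div_pow, sub_pow_char, ← ha, ← hb, hρ, add_sub_cancel_left,
    mul_div_cancel_right₀ _ (pow_ne_zero _ hs)]

end

/-! ### Constructible sets and generic points of ultrafilters -/

section

/-- Subsets of `K ^ ι` that are Boolean combinations of zero loci of polynomials. -/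
inductive IsConstructibleSet {K : Type*} [Field K] {ι : Type*} : Set (ι → K) → Prop
  | zeroLocus (f : MvPolynomial ι K) : IsConstructibleSet {x | MvPolynomial.eval x f = 0}
  | compl {s : Set (ι → K)} : IsConstructibleSet s → IsConstructibleSet sᶜ
  | inter {s t : Set (ι → K)} :
      IsConstructibleSet s → IsConstructibleSet t → IsConstructibleSet (s ∩ t)

namespace IsConstructibleSet

variable {K : Type*} [Field K] {ι ι' : Type*}

lemma union {s t : Set (ι → K)} (hs : IsConstructibleSet s) (ht : IsConstructibleSet t) :
    IsConstructibleSet (s ∪ t) := by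
  rw [← compl_compl (s ∪ t), Set.compl_union]
  exact (hs.compl.inter ht.compl).compl

lemma comap (e : ι → ι') {s : Set (ι → K)} (hs : IsConstructibleSet s) :
    IsConstructibleSet {x : ι' → K | x ∘ e ∈ s} := by
  induction hs with
  | zeroLocus f =>
    convert zeroLocus (MvPolynomial.rename e f) using 2
    simp [MvPolynomial.eval_rename]
  | compl _ ih => exact ih.compl
  | inter _ _ h₁ h₂ => exact h₁.inter h₂

/-- A constructible set contains or avoids a nonempty open subset of any irreducible closed set. -/
lemma exists_notMem_forall (P : Ideal (MvPolynomial ι K)) [hP : P.IsPrime] {s : Set (ι → K)}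
    (hs : IsConstructibleSet s) : ∃ g ∉ P,
      (∀ x : ι → K, (∀ f ∈ P, MvPolynomial.eval x f = 0) → MvPolynomial.eval x g ≠ 0 → x ∈ s) ∨
      (∀ x : ι → K, (∀ f ∈ P, MvPolynomial.eval x f = 0) → MvPolynomial.eval x g ≠ 0 → x ∉ s) := by
  induction hs with
  | zeroLocus f =>
    by_cases hf : f ∈ P
    · exact ⟨1, P.ne_top_iff_one.mp hP.ne_top, .inl fun x hx _ ↦ hx f hf⟩
    · exact ⟨f, hf, .inr fun x _ hx ↦ hx⟩
  | compl _ ih =>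
    obtain ⟨g, hg, h | h⟩ := ih
    · exact ⟨g, hg, .inr fun x hx hgx ↦ not_not_intro (h x hx hgx)⟩
    · exact ⟨g, hg, .inl h⟩
  | inter _ _ h₁ h₂ =>
    obtain ⟨g₁, hg₁, h₁ | h₁⟩ := h₁
    · obtain ⟨g₂, hg₂, h₂ | h₂⟩ := h₂
      · refine ⟨g₁ * g₂, hP.mul_notMem hg₁ hg₂, .inl fun x hx hgx ↦ ?_⟩
        rw [map_mul] at hgx
        exact ⟨h₁ x hx (left_ne_zero_of_mul hgx), h₂ x hx (right_ne_zero_of_mul hgx)⟩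
      · exact ⟨g₂, hg₂, .inr fun x hx hgx hxs ↦ h₂ x hx hgx hxs.2⟩
    · exact ⟨g₁, hg₁, .inr fun x hx hgx hxs ↦ h₁ x hx hgx hxs.1⟩

end IsConstructibleSet

open MvPolynomial Filter

/-- Polynomials that vanish along an ultrafilter of points. -/
def vanishingIdeal {K ι : Type*} [Field K] (U : Ultrafilter (ι → K)) :
    Ideal (MvPolynomial ι K) where
  carrier := {f | ∀ᶠ x in U, eval x f = 0}
  zero_mem' := by simp
  add_mem' hf hg := by
    filter_upwards [hf, hg] with x h₁ h₂
    rw [map_add, h₁, h₂, add_zero]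
  smul_mem' c f hf := by
    filter_upwards [hf] with x h
    rw [smul_eq_mul, map_mul, h, mul_zero]

lemma mem_vanishingIdeal {K ι : Type*} [Field K] {U : Ultrafilter (ι → K)}
    {f : MvPolynomial ι K} : f ∈ vanishingIdeal U ↔ ∀ᶠ x in U, eval x f = 0 := .rfl

instance {K ι : Type*} [Field K] (U : Ultrafilter (ι → K)) : (vanishingIdeal U).IsPrime where
  ne_top' := by
    rw [Ideal.ne_top_iff_one, mem_vanishingIdeal]
    simpa using U.neBot.ne
  mem_or_mem' {f g} h := by
    simpa only [mem_vanishingIdeal, map_mul, mul_eq_zero, Ultrafilter.eventually_or] using h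

/-- The ideal is finitely generated, so infinitely many eventual conditions reduce to finitely many.
-/
lemma eventually_forall_mem_vanishingIdeal {K ι : Type*} [Field K] [Finite ι]
    (U : Ultrafilter (ι → K)) : ∀ᶠ x in U, ∀ f ∈ vanishingIdeal U, eval x f = 0 := by
  obtain ⟨s, hs⟩ := IsNoetherian.noetherian (vanishingIdeal U)
  have h : ∀ᶠ x in U, ∀ f ∈ s, eval x f = 0 := by
    rw [Filter.eventually_all_finset]
    intro f hf
    exact mem_vanishingIdeal.mp (hs ▸ Submodule.subset_span hf)
  filter_upwards [h] with x hx f hf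
  rw [← hs] at hf
  have : Ideal.span (s : Set (MvPolynomial ι K)) ≤ RingHom.ker (eval x) := Ideal.span_le.mpr hx
  exact this hf

/-- The set of tuples of `p`-th powers in an imperfect field of characteristic `p` with plenty of
points on curves is not the projection of a constructible set along fewer coordinates. -/
theorem HasCurvePoints.card_le_card_of_constructible {K : Type u} [Field K] (hK : HasCurvePoints K)
    (p : ℕ) [Fact p.Prime] [CharP K p] {u : K} (hu : ∀ y, u ≠ y ^ p) {ι κ : Type*} [Finite ι]
    [Finite κ] {W : Set (ι ⊕ κ → K)} (hW : IsConstructibleSet W)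
    (hD : ∀ x : ι → K, (∀ i, ∃ y, x i = y ^ p) ↔ ∃ y, Sum.elim x y ∈ W) :
    Nat.card ι ≤ Nat.card κ := by
  classical
  have : Infinite K := by
    by_contra hfin
    have := not_infinite_iff_finite.mp hfin
    obtain ⟨y, hy⟩ := Finite.surjective_of_injective (frobenius_inj K p) u
    exact hu y hy.symm
  have hinf : (Set.range fun y : K ↦ y ^ p).Infinite :=
    Set.infinite_range_of_injective (frobenius_inj K p)
  -- An ultrafilter containing all these sets is concentrated on `W` and off every proper
  -- hypersurface in the `x`-coordinates. The sets are nonempty because a nonzero polynomial cannot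
  -- vanish on a product of infinite sets, and directed because hypersurfaces can be united.
  let B (q : {q : MvPolynomial ι K // q ≠ 0}) : Set (ι ⊕ κ → K) :=
    {z | z ∈ W ∧ eval (z ∘ Sum.inl) q.1 ≠ 0}
  have hB (q) : (B q).Nonempty := by
    by_contra! hemp
    refine q.2 (funext_set (fun _ ↦ Set.range fun y : K ↦ y ^ p) (fun _ ↦ hinf) fun x hx ↦ ?_)
    obtain ⟨y, hy⟩ := (hD x).mp fun i ↦ by
      obtain ⟨y, hy⟩ := hx i trivial
      exact ⟨y, hy.symm⟩
    by_contra h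
    have : Sum.elim x y ∈ B q := ⟨hy, by simpa using h⟩
    rw [hemp] at this
    exact this
  have hne : (⨅ q, 𝓟 (B q)).NeBot := by
    have : Nonempty {q : MvPolynomial ι K // q ≠ 0} := ⟨⟨1, one_ne_zero⟩⟩
    refine iInf_neBot_of_directed' ?_ fun q ↦ principal_neBot_iff.mpr (hB q)
    intro q q'
    refine ⟨⟨q * q', mul_ne_zero q.2 q'.2⟩, ?_, ?_⟩ <;>
    · refine principal_mono.mpr fun z hz ↦ ⟨hz.1, fun h ↦ hz.2 ?_⟩
      simp [h]
  let U := Ultrafilter.of (⨅ q, 𝓟 (B q))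
  have hU (q) : ∀ᶠ z in U, z ∈ B q :=
    Ultrafilter.of_le _ (mem_iInf_of_mem q (mem_principal_self _))
  have hUW : ∀ᶠ z in U, z ∈ W := (hU ⟨1, one_ne_zero⟩).mono fun z hz ↦ hz.1
  let P := vanishingIdeal U
  have hgen {h : MvPolynomial (ι ⊕ κ) K} (hh : h ∉ P) :
      ∃ z, z ∈ W ∧ (∀ f ∈ P, eval z f = 0) ∧ eval z h ≠ 0 :=
    (hUW.and ((eventually_forall_mem_vanishingIdeal U).and
      (Ultrafilter.eventually_not.mpr hh))).exists
  obtain ⟨g, hg, hgW⟩ := hW.exists_notMem_forall P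
  -- The ultrafilter contains points of `W` on the closed set with `g ≠ 0`, so `W` cannot avoid that
  -- open part.
  replace hgW := hgW.resolve_right fun h ↦ by
    obtain ⟨z, hzW, hzP, hzg⟩ := hgen hg
    exact h z hzP hzg hzW
  let A := MvPolynomial (ι ⊕ κ) K ⧸ P
  let a (j : ι ⊕ κ) : A := Ideal.Quotient.mk P (X j)
  have haeval (f : MvPolynomial (ι ⊕ κ) K) : aeval a f = Ideal.Quotient.mk P f := by
    have : aeval a = Ideal.Quotient.mkₐ K P := by ext j; exact aeval_X a j
    rw [this]; rfl
  refine hK.card_le_card p hu (A := A) (a ∘ Sum.inl) (a ∘ Sum.inr) ?_ ?_ ?_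
    (g := Ideal.Quotient.mk P g) (by rwa [ne_eq, Ideal.Quotient.eq_zero_iff_mem]) ?_
  · rw [← Set.Sum.elim_range, Sum.elim_comp_inl_inr, Algebra.adjoin_range_eq_range_aeval,
      AlgHom.range_eq_top]
    intro y
    obtain ⟨f, rfl⟩ := Ideal.Quotient.mk_surjective y
    exact ⟨f, haeval f⟩
  · rw [algebraicIndependent_iff]
    intro q hq
    by_contra hq0
    rw [← aeval_rename, haeval, Ideal.Quotient.eq_zero_iff_mem] at hq
    obtain ⟨z, h₁, h₂⟩ := ((hU ⟨q, hq0⟩).and (mem_vanishingIdeal.mp hq)).exists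
    rw [eval_rename] at h₂
    exact h₁.2 h₂
  · intro b hb
    obtain ⟨h, rfl⟩ := Ideal.Quotient.mk_surjective b
    obtain ⟨z, -, hzP, hzh⟩ := hgen (h := h) (by rwa [ne_eq, Ideal.Quotient.eq_zero_iff_mem] at hb)
    refine ⟨Ideal.Quotient.liftₐ P (aeval z) fun f hf ↦ by simpa [aeval_eq_eval] using hzP f hf, ?_⟩
    change aeval z h ≠ 0
    rwa [aeval_eq_eval]
  · intro σ hσ i
    let z (j : ι ⊕ κ) : K := σ (a j)
    have hz (f : MvPolynomial (ι ⊕ κ) K) : eval z f = σ (Ideal.Quotient.mk P f) := by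
      rw [← haeval, ← AlgHom.comp_apply, comp_aeval, ← aeval_eq_eval]
    have hzW : z ∈ W := hgW z (fun f hf ↦ by
      rw [hz, Ideal.Quotient.eq_zero_iff_mem.mpr hf, map_zero]) (by rwa [hz])
    exact (hD (z ∘ Sum.inl)).mpr ⟨z ∘ Sum.inr, by rwa [Sum.elim_comp_inl_inr]⟩ i

end

/-! ### From quantifiers to projections of constructible sets -/

section

open FirstOrder FirstOrder.Language

variable {K : Type*} [Field K] [FirstOrder.Ring.CompatibleRing K]

/-- Terms in the language of rings with parameters are polynomial functions. -/
lemma exists_eval_eq_realize {α : Type*} (t : FirstOrder.Language.ring[[K]].Term α) :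
    ∃ f : MvPolynomial α K, ∀ x : α → K, t.realize x = MvPolynomial.eval x f := by
  induction t with
  | var i => exact ⟨.X i, fun x ↦ by simp⟩
  | @func l F ts ih =>
    choose f hf using ih
    cases F with
    | inl F =>
      have key (x : α → K) : Term.realize x (Term.func (L := FirstOrder.Language.ring[[K]])
          (Sum.inl F) ts) = Structure.funMap F fun i ↦ MvPolynomial.eval x (f i) :=
        congrArg (Structure.funMap F) (funext fun i ↦ hf i x)
      simp only [key]
      cases F with
      | add =>
        exact ⟨f 0 + f 1, fun x ↦ by rw [map_add]; exact Ring.CompatibleRing.funMap_add _⟩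
      | mul =>
        exact ⟨f 0 * f 1, fun x ↦ by rw [map_mul]; exact Ring.CompatibleRing.funMap_mul _⟩
      | neg =>
        exact ⟨-f 0, fun x ↦ by rw [map_neg]; exact Ring.CompatibleRing.funMap_neg _⟩
      | zero =>
        exact ⟨0, fun x ↦ by rw [map_zero]; exact Ring.CompatibleRing.funMap_zero _⟩
      | one =>
        exact ⟨1, fun x ↦ by rw [map_one]; exact Ring.CompatibleRing.funMap_one _⟩
    | inr c =>
      cases l with
      | zero =>
        refine ⟨.C (Structure.funMap (L := constantsOn K) (M := K) c default), fun x ↦ ?_⟩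
        rw [MvPolynomial.eval_C]
        exact congrArg (Structure.funMap (L := constantsOn K) (M := K) c)
          (Subsingleton.elim (fun i ↦ (ts i).realize x) _)
      | succ l => exact isEmptyElim (α := (constantsOn K).Functions (l + 1)) c

lemma exists_isConstructibleSet_of_isQF {α : Type*} {k : ℕ}
    {φ : FirstOrder.Language.ring[[K]].BoundedFormula α k} (hφ : φ.IsQF) :
    ∃ W : Set (α ⊕ Fin k → K), IsConstructibleSet W ∧
      ∀ v xs, φ.Realize v xs ↔ Sum.elim v xs ∈ W := by
  induction hφ with
  | falsum =>
    exact ⟨_, .zeroLocus 1, fun v xs ↦ by simp [BoundedFormula.Realize]⟩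
  | of_isAtomic h =>
    cases h with
    | equal t₁ t₂ =>
      obtain ⟨f₁, h₁⟩ := exists_eval_eq_realize t₁
      obtain ⟨f₂, h₂⟩ := exists_eval_eq_realize t₂
      refine ⟨_, .zeroLocus (f₁ - f₂), fun v xs ↦ ?_⟩
      rw [BoundedFormula.realize_bdEqual, h₁, h₂, Set.mem_ofPred_eq, map_sub, sub_eq_zero]
    | rel R ts =>
      cases R with
      | inl R => exact isEmptyElim R
      | inr R => exact isEmptyElim R
  | imp _ _ ih₁ ih₂ =>
    obtain ⟨W₁, h₁, h₁'⟩ := ih₁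
    obtain ⟨W₂, h₂, h₂'⟩ := ih₂
    refine ⟨_, h₁.compl.union h₂, fun v xs ↦ ?_⟩
    rw [BoundedFormula.realize_imp, h₁', h₂', imp_iff_not_or]
    rfl

/-- Each quantifier costs one extra coordinate: under `∧` and `∨` the witnesses of the two
subformulas occupy disjoint blocks of `Fin (m₁ + m₂)`, and this needs no prenex form. -/
lemma IsExists.exists_isConstructibleSet {α : Type*} {k m : ℕ}
    {φ : FirstOrder.Language.ring[[K]].BoundedFormula α k} (hφ : IsExists m φ) :
    ∃ W : Set ((α ⊕ Fin k) ⊕ Fin m → K), IsConstructibleSet W ∧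
      ∀ v xs, φ.Realize v xs ↔ ∃ y, Sum.elim (Sum.elim v xs) y ∈ W := by
  induction hφ with
  | qf h =>
    obtain ⟨W, hW, hW'⟩ := exists_isConstructibleSet_of_isQF h
    refine ⟨_, hW.comap Sum.inl, fun v xs ↦ ?_⟩
    rw [hW']
    exact ⟨fun h ↦ ⟨Fin.elim0, h⟩, fun ⟨_, h⟩ ↦ h⟩
  | and _ _ ih₁ ih₂ =>
    obtain ⟨W₁, h₁, h₁'⟩ := ih₁
    obtain ⟨W₂, h₂, h₂'⟩ := ih₂
    refine ⟨_, (h₁.comap (Sum.map id (Fin.castAdd _))).inter (h₂.comap (Sum.map id (Fin.natAdd _))),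
      fun v xs ↦ ?_⟩
    rw [BoundedFormula.realize_inf, h₁', h₂']
    simp only [Set.mem_inter_iff, Set.mem_ofPred_eq, Sum.elim_comp_map, Function.comp_id]
    constructor
    · rintro ⟨⟨y₁, hy₁⟩, y₂, hy₂⟩
      refine ⟨Fin.append y₁ y₂, ?_, ?_⟩
      · convert hy₁ using 2
        ext i
        simp
      · convert hy₂ using 2
        ext i
        simp
    · rintro ⟨y, hy₁, hy₂⟩
      exact ⟨⟨_, hy₁⟩, _, hy₂⟩
  | or _ _ ih₁ ih₂ =>
    obtain ⟨W₁, h₁, h₁'⟩ := ih₁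
    obtain ⟨W₂, h₂, h₂'⟩ := ih₂
    refine ⟨_, (h₁.comap (Sum.map id (Fin.castAdd _))).union (h₂.comap (Sum.map id (Fin.natAdd _))),
      fun v xs ↦ ?_⟩
    rw [BoundedFormula.realize_sup, h₁', h₂']
    simp only [Set.mem_union, Set.mem_ofPred_eq, Sum.elim_comp_map, Function.comp_id]
    constructor
    · rintro (⟨y, hy⟩ | ⟨y, hy⟩)
      -- Only one disjunct has to hold, so the witnesses of the other are filled with `0`.
      · refine ⟨Fin.append y 0, .inl ?_⟩
        convert hy using 2
        ext i
        simp
      · refine ⟨Fin.append 0 y, .inr ?_⟩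
        convert hy using 2
        ext i
        simp
    · rintro ⟨y, hy | hy⟩
      exacts [.inl ⟨_, hy⟩, .inr ⟨_, hy⟩]
  | @ex k m φ _ ih =>
    obtain ⟨W, hW, hW'⟩ := ih
    -- The variable bound by the quantifier is last among the `k + 1` indexed variables and becomes
    -- the first of the `m + 1` witnesses.
    let e : (α ⊕ Fin (k + 1)) ⊕ Fin m → (α ⊕ Fin k) ⊕ Fin (m + 1) :=
      Sum.elim (Sum.elim (Sum.inl ∘ Sum.inl)
        (Fin.snoc (α := fun _ ↦ _) (Sum.inl ∘ Sum.inr) (Sum.inr 0)))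
        (Sum.inr ∘ Fin.succ)
    have he (v : α → K) (xs : Fin k → K) (a : K) (y : Fin m → K) :
        Sum.elim (Sum.elim v xs) (Fin.cons a y) ∘ e = Sum.elim (Sum.elim v (Fin.snoc xs a)) y := by
      ext ((i | i) | i)
      · rfl
      · induction i using Fin.lastCases <;> simp [e]
      · simp [e]
    refine ⟨_, hW.comap e, fun v xs ↦ ?_⟩
    simp only [BoundedFormula.realize_ex, hW', Set.mem_ofPred_eq]
    constructor
    · rintro ⟨a, y, h⟩
      exact ⟨Fin.cons a y, by rwa [he]⟩
    · rintro ⟨y, h⟩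
      refine ⟨y 0, Fin.tail y, ?_⟩
      rwa [← he, Fin.cons_self_tail]

/-- Defining the `n`-tuples of `p`-th powers by an existential formula takes `n` quantifiers. -/
theorem HasCurvePoints.le_of_isExists {K : Type u} [Field K] [FirstOrder.Ring.CompatibleRing K]
    (hK : HasCurvePoints K) (p : ℕ) [Fact p.Prime] [CharP K p] {u : K} (hu : ∀ y, u ≠ y ^ p)
    {n m : ℕ} {ψ : FirstOrder.Language.ring[[K]].Formula (Fin n)} (hψ : IsExists m ψ)
    (h : ∀ x : Fin n → K, ψ.Realize x ↔ x ∈ powerTuples K n p) : n ≤ m := by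
  obtain ⟨W, hW, hW'⟩ := hψ.exists_isConstructibleSet
  let e : (Fin n ⊕ Fin 0) ⊕ Fin m → Fin n ⊕ Fin m := Sum.elim (Sum.elim Sum.inl Fin.elim0) Sum.inr
  have := hK.card_le_card_of_constructible p hu (hW.comap e) fun x ↦ by
    refine (h x).symm.trans ((hW' x default).trans (exists_congr fun y ↦ ?_))
    rw [Set.mem_ofPred_eq]
    refine iff_of_eq (congrArg (· ∈ W) ?_)
    ext ((i | i) | i)
    · rfl
    · exact i.elim0
    · rfl
  simpa using this

end

/-! ### Existential ranks of the power formulas, the power sets and the field -/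

section

open FirstOrder FirstOrder.Language

lemma isQF_onBoundedFormula {L L' : FirstOrder.Language} (g : L →ᴸ L') {α : Type*} {k : ℕ}
    {φ : L.BoundedFormula α k} (h : φ.IsQF) : (g.onBoundedFormula φ).IsQF := by
  induction h with
  | falsum => exact .falsum
  | of_isAtomic h =>
    cases h with
    | equal t₁ t₂ => exact .of_isAtomic (.equal _ _)
    | rel R ts => exact .of_isAtomic (.rel _ _)
  | imp _ _ h₁ h₂ => exact .imp h₁ h₂

lemma IsExists.onBoundedFormula {L L' : FirstOrder.Language} (g : L →ᴸ L') {α : Type*} {k m : ℕ}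
    {φ : L.BoundedFormula α k} (h : IsExists m φ) : IsExists m (g.onBoundedFormula φ) := by
  induction h with
  | qf h => exact .qf (isQF_onBoundedFormula g h)
  | and _ _ h₁ h₂ => exact h₁.and h₂
  | or _ _ h₁ h₂ => exact h₁.or h₂
  | ex _ h => exact h.ex

lemma IsExists.exs {L : FirstOrder.Language} {α : Type*} {k m : ℕ} {φ : L.BoundedFormula α k}
    (h : IsExists m φ) : IsExists (m + k) φ.exs := by
  induction k generalizing m with
  | zero => exact h
  | succ k ih =>
    have := ih h.ex
    rwa [Nat.add_right_comm, Nat.add_assoc] at this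

lemma isQF_iInf {L : FirstOrder.Language} {α β : Type*} {k : ℕ} [Finite β]
    {f : β → L.BoundedFormula α k} (h : ∀ b, (f b).IsQF) : (BoundedFormula.iInf f).IsQF := by
  unfold BoundedFormula.iInf
  dsimp only
  induction (@Finset.univ β (Fintype.ofFinite β)).toList with
  | nil => exact .top
  | cons b l ih => exact (h b).inf ih

lemma isExists_powerFormulaOver (K : Type u) (n m : ℕ) : IsExists n (powerFormulaOver K n m) := by
  refine IsExists.onBoundedFormula _ ?_
  have := (IsExists.qf (isQF_iInf fun i : Fin n ↦ (BoundedFormula.IsAtomic.equal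
    (Term.var (Sum.inl i)) (termPow (Term.var (Sum.inr i)) m)).isQF)).exs
  rwa [Nat.zero_add] at this

variable {K : Type u} [Field K]

lemma realize_termPow [Ring.CompatibleRing K] {α : Type*} (t : FirstOrder.Language.ring.Term α)
    (m : ℕ) (v : α → K) : (termPow t m).realize v = t.realize v ^ m := by
  induction m with
  | zero => simp [termPow]
  | succ m ih => simp [termPow, ih, pow_succ]

lemma realize_powerFormulaOver [Ring.CompatibleRing K] (n m : ℕ) (x : Fin n → K) :
    (powerFormulaOver K n m).Realize x ↔ x ∈ powerTuples K n m := by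
  rw [powerFormulaOver, LHom.realize_onFormula, powerFormula, BoundedFormula.realize_exs]
  simp [realize_termPow, powerTuples, Classical.skolem]

lemma definedSet_powerFormulaOver (n m : ℕ) :
    definedSet K (powerFormulaOver K n m) = powerTuples K n m := by
  let _ := Ring.compatibleRingOfRing K
  exact Set.ext fun x ↦ realize_powerFormulaOver n m x

/-- `K` is a model of its own diagram, so equivalence modulo the diagram can be tested in `K`. -/
lemma definedSet_eq_of_iff {n : ℕ} {φ ψ : FirstOrder.Language.ring[[K]].Formula (Fin n)}
    (h : φ ⇔[fieldDiagram K] ψ) : definedSet K φ = definedSet K ψ := by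
  let _ := Ring.compatibleRingOfRing K
  have : K ⊨ fieldDiagram K := inferInstanceAs (K ⊨ FirstOrder.Language.ring.elementaryDiagram K)
  exact Set.ext fun x ↦ h.realize_iff

/-- Every formula defining the `n`-tuples of `p`-th powers has existential rank at least `n`. -/
theorem HasCurvePoints.le_formulaRank (hK : HasCurvePoints K) (p : ℕ) [Fact p.Prime] [CharP K p]
    {u : K} (hu : ∀ y, u ≠ y ^ p)
    {n : ℕ}
    {φ : FirstOrder.Language.ring[[K]].Formula (Fin n)}
    (hφ : definedSet K φ = powerTuples K n p) : n ≤ formulaRank (fieldDiagram K) φ := by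
  refine le_iInf₂ fun m ⟨ψ, hψ, hφψ⟩ ↦ Nat.cast_le.mpr ?_
  let _ := Ring.compatibleRingOfRing K
  have := (definedSet_eq_of_iff hφψ).symm.trans hφ
  exact hK.le_of_isExists p hu hψ fun x ↦ Set.ext_iff.mp this x

theorem HasCurvePoints.formulaRank_powerFormulaOver (hK : HasCurvePoints K) (p : ℕ)
    [Fact p.Prime] [CharP K p] {u : K} (hu : ∀ y, u ≠ y ^ p) (n : ℕ) :
    formulaRank (fieldDiagram K) (powerFormulaOver K n p) = n :=
  le_antisymm (iInf₂_le n ⟨_, isExists_powerFormulaOver K n p, Theory.Iff.refl _⟩)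
    (hK.le_formulaRank p hu (definedSet_powerFormulaOver n p))

theorem HasCurvePoints.setRank_powerTuples (hK : HasCurvePoints K) (p : ℕ)
    [Fact p.Prime] [CharP K p] {u : K} (hu : ∀ y, u ≠ y ^ p) (n : ℕ) :
    setRank K (powerTuples K n p) = n :=
  le_antisymm ((iInf₂_le (powerFormulaOver K n p) (definedSet_powerFormulaOver n p)).trans_eq
    (hK.formulaRank_powerFormulaOver p hu n)) (le_iInf₂ fun _ ↦ hK.le_formulaRank p hu)

/-- The power formulas are themselves existential, and their ranks `n` are unbounded. -/
theorem HasCurvePoints.fieldRank_eq_top (hK : HasCurvePoints K) (p : ℕ) [Fact p.Prime] [CharP K p]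
    {u : K} (hu : ∀ y, u ≠ y ^ p) :
    fieldRank K = ⊤ :=
  ENat.eq_top_iff_forall_ge.mpr fun n ↦ (hK.formulaRank_powerFormulaOver p hu n).ge.trans <|
    le_iSup₂_of_le n (powerFormulaOver K n p) <|
      le_iSup_of_le ⟨n, isExists_powerFormulaOver K n p⟩ le_rfl

lemma exists_forall_ne_pow_of_not_perfectField (p : ℕ) [Fact p.Prime] [CharP K p]
    (h : ¬ PerfectField K) :
    ∃ u : K, ∀ y, u ≠ y ^ p := by
  by_contra! hsurj
  have := PerfectRing.ofSurjective K p fun u ↦ (hsurj u).imp fun _ hy ↦ hy.symm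
  exact h (PerfectRing.toPerfectField K p)

/-- The uniformizer is not a proper power in a Laurent series field. -/
lemma single_one_ne_pow {F : Type*} [Field F] {m : ℕ} (hm : m ≠ 1) (y : LaurentSeries F) :
    HahnSeries.single (1 : ℤ) (1 : F) ≠ y ^ m := by
  intro h
  have := congrArg HahnSeries.order h
  rw [HahnSeries.order_single one_ne_zero, HahnSeries.order_pow, nsmul_eq_mul] at this
  have := (Int.eq_one_or_neg_one_of_mul_eq_one this.symm).resolve_right (by omega)
  exact hm (by exact_mod_cast this)

end

end ExistentialRank

theorem mainTheorem6 :
    (∀ (p : ℕ) [Fact p.Prime] (K : Type*) [Field K] [CharP K p],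
      ¬ PerfectField K → ExistentialRank.IsLarge K → ∀ n : ℕ,
        ExistentialRank.formulaRank (ExistentialRank.fieldDiagram K)
            (ExistentialRank.powerFormulaOver K n p) = n ∧
          ExistentialRank.setRank K (ExistentialRank.powerTuples K n p) = n) ∧
      ∀ (F : Type*) [Field F] [Finite F],
        ExistentialRank.fieldRank (LaurentSeries F) = ⊤ := by
  refine ⟨fun p _ K _ _ hperf hlarge n ↦ ?_, fun F _ _ ↦ ?_⟩
  · obtain ⟨u, hu⟩ := ExistentialRank.exists_forall_ne_pow_of_not_perfectField p hperf
    have hK := hlarge.hasCurvePoints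
    exact ⟨hK.formulaRank_powerFormulaOver p hu n, hK.setRank_powerTuples p hu n⟩
  · obtain ⟨p, hp⟩ := CharP.exists F
    have : Fact p.Prime :=
      ⟨(CharP.char_is_prime_or_zero F p).resolve_right (CharP.char_ne_zero_of_finite F p)⟩
    have : CharP (LaurentSeries F) p :=
      charP_of_injective_algebraMap (algebraMap F (LaurentSeries F)).injective p
    exact ExistentialRank.hasCurvePoints_laurentSeries.fieldRank_eq_top p
      (ExistentialRank.single_one_ne_pow (Fact.out : p.Prime).ne_one)
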